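/- Write $\mathbb{N}=\{x\in\mathbb{Z}: x\ge 0\}$. "Definable" means first-order definable with parameters from $\mathbb{Z}$. A set $A\subseteq\mathbb{Z}$ is called a Presburger set if it is definable in the structure $(\mathbb{Z},+,<,0)$, and $A$ is said to define the ordering if $\mathbb{N}$ is definable in the structure $(\mathbb{Z},+,0,A)$, the expansion of $(\mathbb{Z},+,0)$ by a unary predicate for $A$. (1) If $A\subseteq\mathbb{Z}$ is a Presburger set, then either $A$ is definable in $(\mathbb{Z},+,0)$ or $A$ defines the ordering. (2) In particular, if $A\subseteq\mathbb{Z}$ is an infinite Presburger set that is bounded above or bounded below, then $A$ defines the ordering. -/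

import Mathlib

/-- The function symbols of the language of `(ℤ, +, 0)`: a constant `0` and a binary `+`. -/
inductive GroupFunc : ℕ → Type
  | zero : GroupFunc 0
  | add : GroupFunc 2

/-- The language `{+, 0}`. -/
def groupLang : FirstOrder.Language.{0, 0} where
  Functions := GroupFunc
  Relations := fun _ => Empty

/-- The structure `(ℤ, +, 0)`. -/
instance groupStructure : groupLang.Structure ℤ where
  funMap
    | GroupFunc.zero, _ => 0
    | GroupFunc.add, v => v 0 + v 1
  RelMap := fun r _ => Empty.elim r

/-- A single binary relation symbol `<`. -/
inductive LtRel : ℕ → Type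
  | lt : LtRel 2

/-- The language `{<}`. -/
def ltLang : FirstOrder.Language.{0, 0} where
  Functions := fun _ => Empty
  Relations := LtRel

/-- The structure `(ℤ, <)`. -/
instance ltStructure : ltLang.Structure ℤ where
  funMap := fun f _ => Empty.elim f
  RelMap
    | LtRel.lt, v => v 0 < v 1

/-- A single unary relation symbol, a name for the set `A`. -/
inductive PredRel (A : Set ℤ) : ℕ → Type
  | mem : PredRel A 1

/-- The language `{A}` with one unary predicate, for the set `A` itself. -/
def setLang (A : Set ℤ) : FirstOrder.Language.{0, 0} where
  Functions := fun _ => Empty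
  Relations := PredRel A

/-- The structure `(ℤ, A)`: the predicate symbol is interpreted as `A`. -/
instance setStructure (A : Set ℤ) : (setLang A).Structure ℤ where
  funMap := fun f _ => Empty.elim f
  RelMap
    | PredRel.mem, v => v 0 ∈ A

/-- `A ⊆ ℤ` is definable, with parameters, in `(ℤ, +, 0)`. -/
def GroupDefinable (A : Set ℤ) : Prop :=
  (Set.univ : Set ℤ).Definable₁ groupLang A

/-- `A ⊆ ℤ` is a Presburger set: it is definable, with parameters, in `(ℤ, +, <, 0)`. -/
def IsPresburger (A : Set ℤ) : Prop :=
  (Set.univ : Set ℤ).Definable₁ (groupLang.sum ltLang) A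

/-- `A` defines the ordering: the set of nonnegative integers is definable, with parameters,
in the expansion `(ℤ, +, 0, A)` of `(ℤ, +, 0)` by a predicate for `A`. -/
def DefinesOrdering (A : Set ℤ) : Prop :=
  (Set.univ : Set ℤ).Definable₁ (groupLang.sum (setLang A)) {x : ℤ | 0 ≤ x}

open FirstOrder FirstOrder.Language Set

/-! ### Sets definable in `(ℤ, +, <, 0)` are semilinear -/

/-! Quantifier elimination enters through semilinear sets: they contain the atomic sets and are
closed under Boolean operations and projection, so a Presburger set is semilinear, hence periodic
with a common period `p` near both ends. If the two ends contain the same classes mod `p`, then `A`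
is a union of classes up to a finite set, hence group-definable. Otherwise some progression `p * z +
x` is in `A` at one end and out at the other, so `{z | p * z + x ∈ A}` is `ℕ` or its complement up
to a finite set. An infinite set bounded on one side has ends that disagree. -/

theorem exists_realize_eq_add_hom {α : Type*} {A : Set ℤ}
    (t : (groupLang.sum ltLang)[[A]].Term α) :
    ∃ (k : ℤ) (f : (α → ℤ) →+ ℤ), ∀ v : α → ℤ, t.realize v = k + f v := by
  induction t with
  | var i => exact ⟨0, Pi.evalAddMonoidHom _ i, fun v => by simp⟩
  | @func l g ts ih =>
    choose k f ih using ih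
    match l, g with
    | _, Sum.inl (Sum.inl GroupFunc.zero) => exact ⟨0, 0, fun v => rfl⟩
    | _, Sum.inl (Sum.inl GroupFunc.add) =>
      refine ⟨k 0 + k 1, f 0 + f 1, fun v => ?_⟩
      change (ts 0).realize v + (ts 1).realize v = _
      rw [ih, ih, AddMonoidHom.add_apply]
      ring
    | _, Sum.inl (Sum.inr g) => exact Empty.elim g
    | 0, Sum.inr c => exact ⟨(c : A), 0, fun v => (add_zero _).symm⟩
    | n + 1, Sum.inr c => exact PEmpty.elim c

theorem Int.isSemilinearSet_Ioi (c : ℤ) : IsSemilinearSet (Ioi c) := by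
  convert (IsSemilinearSet.closure_finset ({1} : Finset ℤ)).vadd (c + 1) using 1
  ext x
  simp only [mem_Ioi, Finset.coe_singleton, mem_vadd_set, SetLike.mem_coe,
    AddSubmonoid.mem_closure_singleton, nsmul_eq_mul, mul_one, vadd_eq_add]
  constructor
  · intro h
    exact ⟨_, ⟨(x - (c + 1)).toNat, rfl⟩, by omega⟩
  · rintro ⟨_, ⟨n, rfl⟩, rfl⟩
    omega

theorem isSemilinearSet_boundedFormula_realize {α : Type*} [Finite α] {A : Set ℤ} {n : ℕ}
    (φ : (groupLang.sum ltLang)[[A]].BoundedFormula α n) :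
    IsSemilinearSet {v : α ⊕ Fin n → ℤ | φ.Realize (v ∘ Sum.inl) (v ∘ Sum.inr)} := by
  induction φ with
  | falsum => exact .empty
  | @equal n t₁ t₂ =>
    obtain ⟨k₁, f₁, h₁⟩ := exists_realize_eq_add_hom t₁
    obtain ⟨k₂, f₂, h₂⟩ := exists_realize_eq_add_hom t₂
    convert isSemilinearSet_setOfPred_eq k₁ k₂ f₁ f₂ using 1
    ext v
    change (t₁.realize _ : ℤ) = t₂.realize _ ↔ _
    rw [Sum.elim_comp_inl_inr, h₁, h₂]
    rfl
  | @rel n l R ts =>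
    match l, R with
    | _, Sum.inl (Sum.inl R) => exact Empty.elim R
    | _, Sum.inr R => exact Empty.elim R
    | _, Sum.inl (Sum.inr LtRel.lt) =>
      obtain ⟨k₁, f₁, h₁⟩ := exists_realize_eq_add_hom (ts 0)
      obtain ⟨k₂, f₂, h₂⟩ := exists_realize_eq_add_hom (ts 1)
      -- The inequality is a ray in `ℤ` pulled back along the difference of the linear parts.
      convert (Int.isSemilinearSet_Ioi (k₁ - k₂)).preimage (f₂ - f₁) using 1
      ext v
      change ((ts 0).realize _ : ℤ) < (ts 1).realize _ ↔ k₁ - k₂ < f₂ v - f₁ v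
      rw [Sum.elim_comp_inl_inr, h₁, h₂]
      constructor <;> intro h <;> linarith
  | @imp n φ ψ ih₁ ih₂ =>
    convert (ih₂.compl.inter ih₁).compl using 1
    ext v
    change (_ → _) ↔ ¬ (¬ _ ∧ _)
    simp only [mem_ofPred_eq]
    tauto
  | @all n φ ih =>
    -- `g` forgets the quantified coordinate; `∀` is complement, projection, complement.
    let g : (α ⊕ Fin (n + 1) → ℤ) →+ (α ⊕ Fin n → ℤ) :=
      { toFun := fun v => v ∘ Sum.map id Fin.castSucc
        map_zero' := rfl
        map_add' := fun _ _ => rfl }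
    convert (ih.compl.image g).compl using 1
    ext v
    change (∀ x, φ.Realize (v ∘ Sum.inl) (Fin.snoc (v ∘ Sum.inr) x)) ↔
      ¬ ∃ w : α ⊕ Fin (n + 1) → ℤ, ¬ φ.Realize (w ∘ Sum.inl) (w ∘ Sum.inr) ∧
        w ∘ Sum.map id Fin.castSucc = v
    constructor
    · rintro h ⟨w, hw, rfl⟩
      apply hw
      have hw' : w ∘ Sum.inr = (Fin.snoc ((w ∘ Sum.map id Fin.castSucc) ∘ Sum.inr)
          (w (Sum.inr (Fin.last n))) : Fin (n + 1) → ℤ) := by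
        funext i
        cases i using Fin.lastCases <;> simp
      rw [hw']
      exact h _
    · intro h x
      by_contra hx
      refine h ⟨Sum.elim (v ∘ Sum.inl) (Fin.snoc (v ∘ Sum.inr) x), hx, ?_⟩
      ext (i | i) <;> simp

theorem IsPresburger.isSemilinearSet {A : Set ℤ} (hA : IsPresburger A) : IsSemilinearSet A := by
  obtain ⟨φ, hφ⟩ := hA
  let g : (Fin 1 ⊕ Fin 0 → ℤ) →+ ℤ := Pi.evalAddMonoidHom _ (Sum.inl 0)
  convert (isSemilinearSet_boundedFormula_realize φ).image g using 1
  have h (v : Fin 1 → ℤ) : v 0 ∈ A ↔ Formula.Realize φ v := Set.ext_iff.1 hφ v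
  ext x
  constructor
  · intro hx
    refine ⟨Sum.elim (fun _ => x) finZeroElim, ?_, rfl⟩
    change BoundedFormula.Realize φ (fun _ => x) _
    have := (h fun _ => x).1 hx
    rw [Formula.Realize] at this
    convert this
  · rintro ⟨w, hw, rfl⟩
    change BoundedFormula.Realize φ _ _ at hw
    refine (h (w ∘ Sum.inl)).2 ?_
    rw [Formula.Realize]
    convert hw

/-- A Presburger set is eventually periodic in both directions, with a common period. -/
theorem IsPresburger.exists_period {A : Set ℤ} (hA : IsPresburger A) :
    ∃ p : ℤ, 0 < p ∧ ∃ N : ℤ, 0 ≤ N ∧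
      (∀ x, N ≤ x → ∀ n : ℕ, (x ∈ A ↔ x + p * n ∈ A)) ∧
      ∀ x, x ≤ -N → ∀ n : ℕ, (x ∈ A ↔ x - p * n ∈ A) := by
  have iter {B : Set ℕ} {k p : ℕ} (h : ∀ x ≥ k, x ∈ B ↔ x + p ∈ B) (x : ℕ) (hx : k ≤ x) (n : ℕ) :
      x ∈ B ↔ x + p * n ∈ B := by
    induction n with
    | zero => simp
    | succ n ih => rw [ih, h _ (by omega), mul_add, mul_one, add_assoc]
  have hs := hA.isSemilinearSet
  obtain ⟨k, p, hp, h⟩ := Nat.isSemilinearSet_iff_ultimately_periodic.1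
    (hs.preimage (Nat.castAddMonoidHom ℤ))
  obtain ⟨l, q, hq, h'⟩ := Nat.isSemilinearSet_iff_ultimately_periodic.1
    (hs.preimage (-Nat.castAddMonoidHom ℤ))
  refine ⟨p * q, by positivity, max k l, by positivity, fun x hx n => ?_, fun x hx n => ?_⟩
  · lift x to ℕ using by omega
    have := iter h x (by omega) (q * n)
    simp only [mem_preimage, Nat.coe_castAddMonoidHom] at this
    push_cast at this
    rwa [← mul_assoc] at this
  · obtain ⟨y, rfl⟩ : ∃ y : ℕ, x = -y := ⟨(-x).toNat, by omega⟩
    have := iter h' y (by omega) (p * n)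
    simp only [mem_preimage, AddMonoidHom.neg_apply, Nat.coe_castAddMonoidHom] at this
    push_cast at this
    rw [this]
    ring_nf

/-! ### Definability in expansions of `(ℤ, +, 0)` -/

section Expansion

variable {L : FirstOrder.Language.{0, 0}} [L.Structure ℤ]

theorem exists_term_realize_eq_mul_add (ψ : groupLang →ᴸ L) [ψ.IsExpansionOn ℤ] {α : Type*}
    (i : α) (m : ℕ) (r : ℤ) :
    ∃ t : L[[(univ : Set ℤ)]].Term α, ∀ v : α → ℤ, t.realize v = m * v i + r := by
  induction m with
  | zero => exact ⟨(L.con (⟨r, mem_univ r⟩ : (univ : Set ℤ))).term, fun v => by simp⟩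
  | succ m ih =>
    obtain ⟨t, ht⟩ := ih
    let g : groupLang.Functions 2 := GroupFunc.add
    let f : L[[(univ : Set ℤ)]].Functions 2 := Sum.inl (ψ.onFunction g)
    refine ⟨f.apply₂ (Term.var i) t, fun v => ?_⟩
    rw [Term.realize_functions_apply₂, withConstants_funMap_sumInl, ψ.map_onFunction]
    change v i + t.realize v = _
    rw [ht]
    push_cast
    ring

theorem Set.Definable₁.preimage_mul_add (ψ : groupLang →ᴸ L) [ψ.IsExpansionOn ℤ] {S : Set ℤ}
    (hS : (univ : Set ℤ).Definable₁ L S) (m : ℕ) (r : ℤ) :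
    (univ : Set ℤ).Definable₁ L {x | m * x + r ∈ S} := by
  obtain ⟨φ, hφ⟩ := hS
  obtain ⟨t, ht⟩ := exists_term_realize_eq_mul_add ψ (0 : Fin 1) m r
  refine ⟨BoundedFormula.subst φ fun _ => t, ?_⟩
  ext v
  have h := Set.ext_iff.1 hφ fun _ => t.realize v
  change t.realize v ∈ S ↔ Formula.Realize φ (fun _ => t.realize v) at h
  change (m : ℤ) * v 0 + r ∈ S ↔ Formula.Realize _ v
  rw [Formula.Realize, BoundedFormula.realize_subst, ← ht]
  exact h

theorem Set.Finite.definable₁ {L : FirstOrder.Language.{0, 0}} {M : Type} [L.Structure M] {F : Set M} (hF : F.Finite) :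
    (univ : Set M).Definable₁ L F := by
  rw [Definable₁]
  convert definable_biUnion_finset (L := L) (A := (univ : Set M))
    (f := fun a => {v : Fin 1 → M | v 0 ∈ ({a} : Set M)})
    (fun a => Definable.singleton_of_mem L (mem_univ a)) hF.toFinset using 1
  ext v
  simp

/-- With parameters every finite set is definable, so a finite discrepancy is harmless. -/
theorem Set.Definable₁.of_eventuallyEq {S T : Set ℤ} (hS : (univ : Set ℤ).Definable₁ L S) (N : ℤ)
    (h : ∀ x, N ≤ |x| → (x ∈ T ↔ x ∈ S)) : (univ : Set ℤ).Definable₁ L T := by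
  have hfin : (Icc (-N) N).Finite := finite_Icc _ _
  have h₁ : (univ : Set ℤ).Definable₁ L (Icc (-N) N) := hfin.definable₁
  have h₂ : (univ : Set ℤ).Definable₁ L (T ∩ Icc (-N) N) := (hfin.inter_of_right T).definable₁
  rw [Definable₁]
  convert (Definable.sdiff hS h₁).union h₂ using 1
  ext v
  have := h (v 0)
  by_cases hv : v 0 ∈ Icc (-N) N
  · simp only [mem_ofPred_eq, mem_union, mem_sdiff, mem_inter_iff]
    tauto
  · have : v 0 ∈ T ↔ v 0 ∈ S := this (by rw [mem_Icc] at hv; grind)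
    simp only [mem_ofPred_eq, mem_union, mem_sdiff, mem_inter_iff]
    tauto

theorem definable₁_emod_eq (ψ : groupLang →ᴸ L) [ψ.IsExpansionOn ℤ] (p : ℕ) (r : ℤ) :
    (univ : Set ℤ).Definable₁ L {x | ∃ y : ℤ, x = p * y + r} := by
  obtain ⟨t, ht⟩ := exists_term_realize_eq_mul_add ψ (1 : Fin 2) p r
  have h : (univ : Set ℤ).Definable L {v : Fin 2 → ℤ | v 0 = p * v 1 + r} :=
    ⟨Term.equal (Term.var 0) t, by ext v; simp [ht]⟩
  rw [Definable₁]
  convert h.image_comp ![0] using 1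
  ext v
  constructor
  · rintro ⟨y, hy⟩
    exact ⟨![v 0, y], hy, by ext i; fin_cases i; rfl⟩
  · rintro ⟨w, hw, rfl⟩
    exact ⟨w 1, hw⟩

theorem definable₁_of_periodic (ψ : groupLang →ᴸ L) [ψ.IsExpansionOn ℤ] {P : Set ℤ} {p : ℤ}
    (hp : 0 < p) (hP : ∀ x y, x ≡ y [ZMOD p] → (x ∈ P ↔ y ∈ P)) :
    (univ : Set ℤ).Definable₁ L P := by
  classical
  lift p to ℕ using hp.le
  rw [Definable₁]
  convert definable_biUnion_finset (L := L) (A := (univ : Set ℤ))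
    (f := fun r => {v : Fin 1 → ℤ | v 0 ∈ {x : ℤ | ∃ y : ℤ, x = p * y + r}})
    (fun r => definable₁_emod_eq ψ p r) {r ∈ Finset.Ico (0 : ℤ) p | r ∈ P} using 1
  ext v
  simp only [mem_ofPred_eq, Finset.mem_filter, Finset.mem_Ico, mem_iUnion, exists_prop]
  constructor
  · intro hv
    exact ⟨v 0 % p, ⟨⟨Int.emod_nonneg _ hp.ne', Int.emod_lt_of_pos _ hp⟩,
      (hP _ _ (Int.mod_modEq _ _)).2 hv⟩, v 0 / p, (Int.mul_ediv_add_emod _ _).symm⟩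
  · rintro ⟨r, ⟨-, hr⟩, y, hy⟩
    refine (hP _ _ ?_).2 hr
    rw [hy]
    exact Int.modEq_iff_dvd.2 ⟨-y, by ring⟩

end Expansion

/-! ### The dichotomy -/

theorem definable₁_setLang (A : Set ℤ) :
    (univ : Set ℤ).Definable₁ (groupLang.sum (setLang A)) A := by
  let R : (groupLang.sum (setLang A))[[(univ : Set ℤ)]].Relations 1 :=
    Sum.inl (Sum.inr PredRel.mem)
  exact ⟨R.formula₁ (Term.var 0), rfl⟩

/-- If `A` is a Presburger set which does not define the ordering, then the two ends of `A` consist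
of the same residue classes. -/
theorem IsPresburger.definesOrdering_or {A : Set ℤ} (hA : IsPresburger A) :
    DefinesOrdering A ∨ ∃ p : ℤ, 0 < p ∧ ∃ N : ℤ, 0 ≤ N ∧
      (∀ x y, N ≤ x → N ≤ y → x ≡ y [ZMOD p] → (x ∈ A ↔ y ∈ A)) ∧
      (∀ x y, N ≤ x → y ≤ -N → x ≡ y [ZMOD p] → (x ∈ A ↔ y ∈ A)) := by
  obtain ⟨p, hp, N, hN, hpos, hneg⟩ := hA.exists_period
  by_cases h : ∀ x y, N ≤ x → y ≤ -N → x ≡ y [ZMOD p] → (x ∈ A ↔ y ∈ A)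
  · refine Or.inr ⟨p, hp, N, hN, fun x y hx hy hxy => ?_, h⟩
    -- Two points of the right end are compared through the largest point of their class in the left
    -- end.
    have hz : -N - (-N - x) % p ≤ -N := by
      have := Int.emod_nonneg (-N - x) hp.ne'
      omega
    have hzx : x ≡ -N - (-N - x) % p [ZMOD p] :=
      Int.modEq_iff_dvd.2 ⟨(-N - x) / p, by have := Int.mul_ediv_add_emod (-N - x) p; linarith⟩
    rw [h x _ hx hz hzx, h y _ hy hz (hxy.symm.trans hzx)]
  · left
    push Not at h
    obtain ⟨x, y, hx, hy, hxy, hne⟩ := h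
    -- The progression `p * z + x` reaches `y` at `z = k`; only `k < z < 0` escapes the two ends.
    obtain ⟨k, hk⟩ := hxy.dvd
    have hS := (definable₁_setLang A).preimage_mul_add (LHom.sumInl : groupLang →ᴸ _) p.toNat x
    have hright (z : ℤ) (hz : 0 ≤ z) : p * z + x ∈ A ↔ x ∈ A := by
      lift z to ℕ using hz
      rw [hpos x hx z, add_comm]
    have hleft (z : ℤ) (hz : z ≤ k) : p * z + x ∈ A ↔ y ∈ A := by
      rw [hneg y hy (k - z).toNat, Int.toNat_of_nonneg (by omega)]
      congr! 1
      linear_combination -hk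
    have hk0 : k ≤ 0 := by
      by_contra hk0
      have : 0 < p * k := mul_pos hp (by omega)
      omega
    rw [Int.toNat_of_nonneg hp.le] at hS
    have key : (∀ z, |k| + 1 ≤ |z| → (z ∈ {x : ℤ | 0 ≤ x} ↔ z ∈ {z | p * z + x ∈ A})) ∨
        ∀ z, |k| + 1 ≤ |z| → (z ∈ {x : ℤ | 0 ≤ x} ↔ z ∈ {z | p * z + x ∈ A}ᶜ) := by
      by_cases hxA : x ∈ A
      · left
        intro z hz
        rcases le_or_gt 0 z with h0 | h0
        · simp [h0, hright z h0, hxA]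
        · have hzk : z ≤ k := by grind
          simp only [mem_ofPred_eq, hleft z hzk]
          grind
      · right
        intro z hz
        rcases le_or_gt 0 z with h0 | h0
        · simp [h0, hright z h0, hxA]
        · have hzk : z ≤ k := by grind
          simp only [mem_compl_iff, mem_ofPred_eq, hleft z hzk]
          grind
    rcases key with key | key
    · exact hS.of_eventuallyEq _ key
    · exact Definable₁.of_eventuallyEq (L := groupLang.sum (setLang A))
        (S := {z | p * z + x ∈ A}ᶜ) (Definable.compl hS) _ key

theorem corollary3p3 :
    (∀ A : Set ℤ, IsPresburger A → GroupDefinable A ∨ DefinesOrdering A) ∧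
    (∀ A : Set ℤ, IsPresburger A → A.Infinite → (BddAbove A ∨ BddBelow A) →
      DefinesOrdering A) := by
  refine ⟨fun A hA => ?_, fun A hA hinf hbdd => ?_⟩
  · obtain h | ⟨p, hp, N, hN, h₁, h₂⟩ := hA.definesOrdering_or
    · exact Or.inr h
    left
    have hP : (univ : Set ℤ).Definable₁ groupLang {x | ∃ y, N ≤ y ∧ x ≡ y [ZMOD p] ∧ y ∈ A} :=
      definable₁_of_periodic (LHom.id _) hp fun x z hxz =>
        exists_congr fun y => and_congr_right fun _ => and_congr_left fun _ =>
          ⟨fun h => hxz.symm.trans h, fun h => hxz.trans h⟩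
    refine hP.of_eventuallyEq N fun x hx => ?_
    simp only [mem_ofPred_eq]
    rcases le_abs.1 hx with hx | hx
    · exact ⟨fun h => ⟨x, hx, rfl, h⟩, fun ⟨y, hy, hxy, hyA⟩ => (h₁ x y hx hy hxy).2 hyA⟩
    · constructor
      · intro h
        -- This is the least point of the class of `x` in the right end.
        have hy : N ≤ N + (x - N) % p := by
          have := Int.emod_nonneg (x - N) hp.ne'
          omega
        have hxy : x ≡ N + (x - N) % p [ZMOD p] :=
          Int.modEq_iff_dvd.2 ⟨-((x - N) / p), by
            have := Int.mul_ediv_add_emod (x - N) p; linarith⟩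
        exact ⟨_, hy, hxy, (h₂ _ x hy (by omega) hxy.symm).2 h⟩
      · rintro ⟨y, hy, hxy, hyA⟩
        exact (h₂ y x hy (by omega) hxy.symm).1 hyA
  · obtain h | ⟨p, hp, N, hN, h₁, h₂⟩ := hA.definesOrdering_or
    · exact h
    exfalso
    rcases hbdd with ⟨b, hb⟩ | ⟨b, hb⟩
    · obtain ⟨y, hyA, hy⟩ : ∃ y ∈ A, y ≤ -N := by
        by_contra! h
        exact hinf ((finite_Icc (-N) b).subset fun y hy => ⟨(h y hy).le, hb hy⟩)
      -- The shift is a multiple of `p` large enough to carry `y` past both `N` and `b`.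
      have hle : |y| + |b| + N + 1 ≤ p * (|y| + |b| + N + 1) :=
        le_mul_of_one_le_left (by positivity) hp
      have hmem := hb ((h₂ (y + p * (|y| + |b| + N + 1)) y (by grind) hy
        (Int.modEq_iff_dvd.2 ⟨-(|y| + |b| + N + 1), by ring⟩)).2 hyA)
      grind
    · obtain ⟨x, hxA, hx⟩ : ∃ x ∈ A, N ≤ x := by
        by_contra! h
        exact hinf ((finite_Icc b N).subset fun y hy => ⟨hb hy, (h y hy).le⟩)
      have hle : |x| + |b| + N + 1 ≤ p * (|x| + |b| + N + 1) :=
        le_mul_of_one_le_left (by positivity) hp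
      have hmem := hb ((h₂ x (x - p * (|x| + |b| + N + 1)) hx (by grind)
        (Int.modEq_iff_dvd.2 ⟨-(|x| + |b| + N + 1), by ring⟩)).1 hxA)
      grind
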